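/- Theorem B.3 (Replicable Quantile Estimation). For an integer $R\ge 1$ write $[R]=\{1,\dots,R\}$, and consider the following randomized algorithm. Its input consists of samples $x_1,\dots,x_n$, a quantile level $q$, an accuracy $\alpha$, a replicability parameter $\rho$ and a confidence parameter $\beta$. Set $\ell\leftarrow 0$, $h\leftarrow R$. While $\ell<h-1$: set $m\leftarrow\lfloor(\ell+h)/2\rfloor$; compute the empirical CDF $F_n(m)=\frac1n\#\{j: x_j\le m\}$; replace it by the rounded value $\widetilde F_n(m)$ obtained from replicable rounding with accuracy $\alpha'=\frac{\alpha\rho}{4\log_2R}$ and replicability $\rho'=\frac{\rho}{\log_2R}$, i.e. put $L=6\alpha'/\rho'$, draw a fresh $L_0$ uniformly from $[0,L)$, and let $\widetilde F_n(m)$ be the midpoint of that interval $[L_0+kL,L_0+(k+1)L)$, $k\in\mathbb Z$, which contains $F_n(m)$; if $\widetilde F_n(m)\ge q$ set $h\leftarrow m$, otherwise set $\ell\leftarrow m$. Return $h$. Let $\alpha,\rho\in(0,1)$, $\beta\in(0,\rho/3)$, $q\in[0,1]$, and suppose that the number $n$ of samples is at least $$\frac{16\log_2^2(R)}{2\alpha^2\rho^2}\ln\frac2\beta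 = O\!\left(\frac{\log^2R}{\alpha^2\rho^2}\ln\frac1\beta\right).$$ Then: 1. For all samples and all internal random numbers the algorithm terminates in time at most $P(n)$, where $P$ is a fixed polynomial that does not depend on $R,\alpha,\rho,\beta,q$. Time is counted on a real random access machine: reading a register, a constant or a sample, an arithmetic operation, a binary logarithm, a comparison, drawing a uniform random number, an assignment and a control step cost one unit each, and rounding down to an integer costs one unit plus the bit length of the result. 2. For every distribution $D$ on $[R]$ the algorithm is $\rho$-replicable under $D$: if $S,S'\sim D^n$ are independent and $r$ is the internal randomness, independent of $(S,S')$ and shared by both runs, then the outputs on $(S,r)$ and $(S',r)$ differ with probability at most $\rho$. 3. For every distribution $D$ on $[R]$ with CDF $F$, given $n$ i.i.d. samples from $D$, with probability at least $1-\beta$ the algorithm outputs some $x\in[R]$ with $F(x)\ge q-\alpha$ and $F(x-1)<q+\alpha$. -/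

import Mathlib

open MeasureTheory

noncomputable section

/-!
A real random access machine: registers hold real numbers, the input samples are stored in a
read-only array, and a tape supplies independent uniform random numbers from `[0, 1)`.
Programs are syntax trees, executed one command at a time by a machine with a clock.
-/
namespace RealRAM

/-- Expressions over the registers `V`. -/
inductive Expr (V : Type) where
  | lit (k : ℕ)
  | var (v : V)
  | read (e : Expr V)
  | add (a b : Expr V)
  | sub (a b : Expr V)
  | mul (a b : Expr V)
  | div (a b : Expr V)
  | log2 (e : Expr V)
  | floor (e : Expr V)

/-- Comparisons. -/
inductive Test (V : Type) where
  | le (a b : Expr V)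
  | lt (a b : Expr V)

/-- Programs. `uniform v e` draws a fresh uniform sample of `[0, e)` into the register `v`. -/
inductive Cmd (V : Type) where
  | skip
  | assign (v : V) (e : Expr V)
  | uniform (v : V) (e : Expr V)
  | seq (p q : Cmd V)
  | branch (t : Test V) (p q : Cmd V)
  | loop (t : Test V) (p : Cmd V)

variable {V : Type}

/-- The value of an expression, given the input array `x` and the contents `s` of the registers. -/
def Expr.eval (x : ℕ → ℝ) (s : V → ℝ) : Expr V → ℝ
  | .lit k => k
  | .var v => s v
  | .read e => x ⌊e.eval x s⌋₊
  | .add a b => a.eval x s + b.eval x s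
  | .sub a b => a.eval x s - b.eval x s
  | .mul a b => a.eval x s * b.eval x s
  | .div a b => a.eval x s / b.eval x s
  | .log2 e => Real.logb 2 (e.eval x s)
  | .floor e => (⌊e.eval x s⌋ : ℝ)

/-- The time to evaluate an expression: one unit for every operation, and for a `floor` in addition
the bit length of the integer that it produces. -/
def Expr.cost (x : ℕ → ℝ) (s : V → ℝ) : Expr V → ℕ
  | .lit _ => 1
  | .var _ => 1
  | .read e => e.cost x s + 1
  | .add a b => a.cost x s + b.cost x s + 1
  | .sub a b => a.cost x s + b.cost x s + 1
  | .mul a b => a.cost x s + b.cost x s + 1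
  | .div a b => a.cost x s + b.cost x s + 1
  | .log2 e => e.cost x s + 1
  | .floor e => e.cost x s + 1 + Nat.size ⌊e.eval x s⌋.natAbs

/-- The truth value of a comparison. -/
def Test.holds (x : ℕ → ℝ) (s : V → ℝ) : Test V → Prop
  | .le a b => a.eval x s ≤ b.eval x s
  | .lt a b => a.eval x s < b.eval x s

/-- The time to evaluate a comparison. -/
def Test.cost (x : ℕ → ℝ) (s : V → ℝ) : Test V → ℕ
  | .le a b => a.cost x s + b.cost x s + 1
  | .lt a b => a.cost x s + b.cost x s + 1

/-- A configuration: the commands that remain to be executed, the contents of the registers, the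
number of random numbers used so far, and the clock. -/
structure Config (V : Type) where
  todo : List (Cmd V)
  store : V → ℝ
  used : ℕ
  time : ℕ

open Classical in
/-- One step of the machine with input array `x` and random tape `r`. A configuration in which
nothing remains to be executed is final. -/
def Config.step [DecidableEq V] (x r : ℕ → ℝ) (c : Config V) : Config V :=
  match c.todo with
  | [] => c
  | .skip :: k => ⟨k, c.store, c.used, c.time + 1⟩
  | .assign v e :: k =>
      ⟨k, Function.update c.store v (e.eval x c.store), c.used, c.time + e.cost x c.store + 1⟩
  | .uniform v e :: k =>
      ⟨k, Function.update c.store v (e.eval x c.store * r c.used), c.used + 1,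
        c.time + e.cost x c.store + 1⟩
  | .seq p q :: k => ⟨p :: q :: k, c.store, c.used, c.time + 1⟩
  | .branch t p q :: k =>
      ⟨(if t.holds x c.store then p else q) :: k, c.store, c.used,
        c.time + t.cost x c.store + 1⟩
  | .loop t p :: k =>
      ⟨if t.holds x c.store then p :: .loop t p :: k else k, c.store, c.used,
        c.time + t.cost x c.store + 1⟩

/-- The initial configuration of the program `p` with initial register contents `s`. -/
def start (p : Cmd V) (s : V → ℝ) : Config V := ⟨[p], s, 0, 0⟩

/-- The execution that starts in `c` reaches a final configuration. -/
def Halts [DecidableEq V] (x r : ℕ → ℝ) (c : Config V) : Prop :=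
  ∃ k : ℕ, ((Config.step x r)^[k] c).todo = []

open Classical in
/-- The final configuration of a halting execution. -/
def final [DecidableEq V] (x r : ℕ → ℝ) (c : Config V) : Config V :=
  if h : Halts x r c then (Config.step x r)^[Nat.find h] c else c

/-- The uniform distribution on `[0, 1)`. -/
def unif : Measure ℝ := volume.restrict (Set.Ico 0 1)

instance : IsProbabilityMeasure unif :=
  ⟨by simp [unif]⟩

/-- The law of the random tape: independent uniform random numbers from `[0, 1)`. -/
def tapeLaw : Measure (ℕ → ℝ) := Measure.infinitePi fun _ => unif

end RealRAM

/-- The law of `n` independent samples from `D`. -/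
def samplesLaw {X : Type*} [MeasurableSpace X] (D : Measure X) (n : ℕ) : Measure (Fin n → X) :=
  Measure.pi fun _ => D

/-- The `n`-sample algorithm `A`, whose internal randomness has the law `ν`, is `ρ`-replicable under
the distribution `D`: on two independent sequences of samples, with the same internal randomness,
the two outputs differ with probability at most `ρ`. -/
def IsReplicable {X Ω Y : Type*} [MeasurableSpace X] [MeasurableSpace Ω] (n : ℕ)
    (A : (Fin n → X) → Ω → Y) (D : Measure X) (ν : Measure Ω) (ρ : ℝ) : Prop :=
  ((samplesLaw D n).prod ((samplesLaw D n).prod ν)) {w | A w.1 w.2.2 ≠ A w.2.1 w.2.2}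
    ≤ ENNReal.ofReal ρ

namespace QuantileEst

open RealRAM

/-- The registers of the program: the inputs `R`, `n`, `q`, `α`, `ρ`, `β`, the end points `lo`, `hi`
of the current search interval and its midpoint `mid`, a counter `cnt` and an index `j` for the
computation of the empirical CDF `Fmid`, and the width `L`, the offset `off` and the result
`Fround` of the rounding. -/
inductive Reg where
  | R | n | q | α | ρ | β | lo | hi | mid | cnt | j | Fmid | L | off | Fround
  deriving DecidableEq

/-- `Fmid ← (1 / n) * #{j | x j ≤ mid}`. -/
def empiricalCdf : Cmd Reg :=
  .seq (.assign .cnt (.lit 0)) <|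
  .seq (.assign .j (.lit 0)) <|
  .seq
    (.loop (.lt (.var .j) (.var .n)) <|
      .seq
        (.branch (.le (.read (.var .j)) (.var .mid))
          (.assign .cnt (.add (.var .cnt) (.lit 1)))
          .skip)
        (.assign .j (.add (.var .j) (.lit 1))))
    (.assign .Fmid (.div (.var .cnt) (.var .n)))

/-- Replicable rounding of the value `g` with accuracy `acc` and replicability `rep`: the real line
is cut into the intervals `[off + k * L, off + (k + 1) * L)`, where `L = 6 * acc / rep` and `off` is
uniform in `[0, L)`, and `Fround` becomes the midpoint of the interval that contains `g`. -/
def rRound (g acc rep : Expr Reg) : Cmd Reg :=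
  .seq (.assign .L (.div (.mul (.lit 6) acc) rep)) <|
  .seq (.uniform .off (.var .L)) <|
  .assign .Fround
    (.add (.var .off)
      (.mul
        (.add (.floor (.div (.sub g (.var .off)) (.var .L))) (.div (.lit 1) (.lit 2)))
        (.var .L)))

/-- The accuracy `α * ρ / (4 * log₂ R)` of the rounding. -/
def acc : Expr Reg := .div (.mul (.var .α) (.var .ρ)) (.mul (.lit 4) (.log2 (.var .R)))

/-- The replicability `ρ / log₂ R` of the rounding. -/
def rep : Expr Reg := .div (.var .ρ) (.log2 (.var .R))

/-- Replicable quantile estimation: binary search for the quantile with replicable rounding of the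
empirical CDF at the midpoints. The register `hi` holds the output. -/
def rQuantileEst : Cmd Reg :=
  .seq (.assign .lo (.lit 0)) <|
  .seq (.assign .hi (.var .R)) <|
  .loop (.lt (.var .lo) (.sub (.var .hi) (.lit 1))) <|
    .seq (.assign .mid (.floor (.div (.add (.var .lo) (.var .hi)) (.lit 2)))) <|
    .seq empiricalCdf <|
    .seq (rRound (.var .Fmid) acc rep) <|
    .branch (.le (.var .q) (.var .Fround))
      (.assign .hi (.var .mid))
      (.assign .lo (.var .mid))

/-- The initial contents of the registers: the inputs, and zero elsewhere. -/
def inputs (R n : ℕ) (q α ρ β : ℝ) : Reg → ℝ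
  | .R => R
  | .n => n
  | .q => q
  | .α => α
  | .ρ => ρ
  | .β => β
  | _ => 0

/-- The input array that holds the samples `S`. -/
def sampleArray {n : ℕ} (S : Fin n → ℕ) (j : ℕ) : ℝ :=
  if h : j < n then (S ⟨j, h⟩ : ℝ) else 0

/-- The algorithm halts on the samples `S` with the random tape `r`. -/
def Terminates (R : ℕ) (q α ρ β : ℝ) {n : ℕ} (S : Fin n → ℕ) (r : ℕ → ℝ) : Prop :=
  Halts (sampleArray S) r (start rQuantileEst (inputs R n q α ρ β))

/-- The final configuration of the algorithm on the samples `S` with the random tape `r`. -/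
def finalConfig (R : ℕ) (q α ρ β : ℝ) {n : ℕ} (S : Fin n → ℕ) (r : ℕ → ℝ) : Config Reg :=
  final (sampleArray S) r (start rQuantileEst (inputs R n q α ρ β))

/-- The running time of the algorithm. -/
def runningTime (R : ℕ) (q α ρ β : ℝ) {n : ℕ} (S : Fin n → ℕ) (r : ℕ → ℝ) : ℕ :=
  (finalConfig R q α ρ β S r).time

/-- The output of the algorithm. -/
def output (R : ℕ) (q α ρ β : ℝ) {n : ℕ} (S : Fin n → ℕ) (r : ℕ → ℝ) : ℝ :=
  (finalConfig R q α ρ β S r).store .hi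

/-- The number of samples that suffices. -/
def sampleSize (R : ℕ) (α ρ β : ℝ) : ℝ :=
  16 * Real.logb 2 R ^ 2 / (2 * α ^ 2 * ρ ^ 2) * Real.log (2 / β)

/-- The cumulative distribution function of a distribution on the natural numbers. -/
def distCdf (D : Measure ℕ) (x : ℕ) : ℝ := D.real (Set.Iic x)

end QuantileEst

end

open RealRAM QuantileEst

/-! The program is a binary search whose step `i` depends on the samples only through the value
`empCdf S m` at its midpoint `m`, rounded to a grid with offset `r i`. In the rounding width the
logarithms and `ρ` cancel: `L = 3 / 2 * α` for `R ≥ 2` (`width_eq`).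

Replicability. Both runs are compared with an ideal search that rounds the true CDF `F` with the
same offsets. Its query at step `i` is a function of `r 0, …, r (i - 1)`, hence independent of `r i`
and of the samples (`tapeLaw_query_inter`). A random grid separates two values with probability at
most their distance over `L` (`unif_lower_ne_le`), and the mean distance of empirical and true CDF
at a fixed point is at most `1 / (2 * √n)`, by the variance. Summed over the `⌈log₂ R⌉` steps, one
run leaves the ideal one with probability at most `ρ / 3` (`measure_diverge_le`), so the two runs
differ with probability at most `2 * ρ / 3`.

Correctness. Hoeffding and a union bound over `1, …, R - 1` make all empirical values `α /
4`-accurate outside an event of probability `β` (`union_bound_le`). Rounding adds at most `L / 2 = 3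
/ 4 * α`, so every decision is right up to `α`, and the search interval always brackets the quantile
(`path_brackets`).

Running time. The sample bound forces `R ≤ 2 ^ n` and `α⁻¹ + 1 ≤ n`, so the number of iterations and
all bit lengths are linear in `n`. -/

namespace RealRAM

/-! ### Compositional execution rules for the machine -/

variable {V : Type} [DecidableEq V] {x r : ℕ → ℝ}

/-- The command `p`, started with registers `s` after `u` random draws, takes time `t` and leaves
registers `s'` and `u'` random draws. -/
def Exec (x r : ℕ → ℝ) (p : Cmd V) (s : V → ℝ) (u : ℕ) (s' : V → ℝ) (u' t : ℕ) : Prop :=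
  ∀ (k : List (Cmd V)) (t₀ : ℕ), ∃ m : ℕ,
    (Config.step x r)^[m] ⟨p :: k, s, u, t₀⟩ = ⟨k, s', u', t₀ + t⟩

theorem Exec.skip (s : V → ℝ) (u : ℕ) : Exec x r .skip s u s u 1 :=
  fun _ _ => ⟨1, rfl⟩

theorem Exec.assign (v : V) (e : Expr V) (s : V → ℝ) (u : ℕ) :
    Exec x r (.assign v e) s u (Function.update s v (e.eval x s)) u (e.cost x s + 1) :=
  fun _ _ => ⟨1, rfl⟩

theorem Exec.assign_of_eq (v : V) (e : Expr V) {s s' : V → ℝ} (u : ℕ)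
    (h : s' = Function.update s v (e.eval x s)) :
    Exec x r (.assign v e) s u s' u (e.cost x s + 1) :=
  h ▸ Exec.assign v e s u

theorem Exec.uniform (v : V) (e : Expr V) (s : V → ℝ) (u : ℕ) :
    Exec x r (.uniform v e) s u (Function.update s v (e.eval x s * r u)) (u + 1)
      (e.cost x s + 1) :=
  fun _ _ => ⟨1, rfl⟩

theorem Exec.seq {p q : Cmd V} {s s' s'' : V → ℝ} {u u' u'' t t' : ℕ}
    (hp : Exec x r p s u s' u' t) (hq : Exec x r q s' u' s'' u'' t') :
    Exec x r (.seq p q) s u s'' u'' (1 + t + t') := by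
  intro k t₀
  obtain ⟨m, hm⟩ := hp (q :: k) (t₀ + 1)
  obtain ⟨m', hm'⟩ := hq k (t₀ + 1 + t)
  refine ⟨m' + m + 1, ?_⟩
  rw [Function.iterate_add_apply, Function.iterate_add_apply]
  have h1 : (Config.step x r)^[1] ⟨.seq p q :: k, s, u, t₀⟩ = ⟨p :: q :: k, s, u, t₀ + 1⟩ := rfl
  rw [h1, hm, hm']
  simp only [add_assoc]

theorem Exec.branch_true {c : Test V} {p q : Cmd V} {s s' : V → ℝ} {u u' t : ℕ}
    (hc : c.holds x s) (hp : Exec x r p s u s' u' t) :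
    Exec x r (.branch c p q) s u s' u' (c.cost x s + 1 + t) := by
  intro k t₀
  obtain ⟨m, hm⟩ := hp k (t₀ + c.cost x s + 1)
  refine ⟨m + 1, ?_⟩
  rw [Function.iterate_add_apply]
  have h1 : (Config.step x r)^[1] ⟨.branch c p q :: k, s, u, t₀⟩ =
      ⟨p :: k, s, u, t₀ + c.cost x s + 1⟩ := by
    simp [Config.step, hc]
  rw [h1, hm]
  simp only [add_assoc]

theorem Exec.branch_false {c : Test V} {p q : Cmd V} {s s' : V → ℝ} {u u' t : ℕ}
    (hc : ¬ c.holds x s) (hq : Exec x r q s u s' u' t) :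
    Exec x r (.branch c p q) s u s' u' (c.cost x s + 1 + t) := by
  intro k t₀
  obtain ⟨m, hm⟩ := hq k (t₀ + c.cost x s + 1)
  refine ⟨m + 1, ?_⟩
  rw [Function.iterate_add_apply]
  have h1 : (Config.step x r)^[1] ⟨.branch c p q :: k, s, u, t₀⟩ =
      ⟨q :: k, s, u, t₀ + c.cost x s + 1⟩ := by
    simp [Config.step, hc]
  rw [h1, hm]
  simp only [add_assoc]

theorem Exec.loop_false {c : Test V} {p : Cmd V} {s : V → ℝ} {u : ℕ} (hc : ¬ c.holds x s) :
    Exec x r (.loop c p) s u s u (c.cost x s + 1) :=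
  fun k t₀ => ⟨1, by simp [Config.step, hc, add_assoc]⟩

theorem Exec.loop_true {c : Test V} {p : Cmd V} {s s' s'' : V → ℝ} {u u' u'' t t' : ℕ}
    (hc : c.holds x s) (hp : Exec x r p s u s' u' t)
    (hl : Exec x r (.loop c p) s' u' s'' u'' t') :
    Exec x r (.loop c p) s u s'' u'' (c.cost x s + 1 + t + t') := by
  intro k t₀
  obtain ⟨m, hm⟩ := hp (.loop c p :: k) (t₀ + c.cost x s + 1)
  obtain ⟨m', hm'⟩ := hl k (t₀ + c.cost x s + 1 + t)
  refine ⟨m' + m + 1, ?_⟩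
  rw [Function.iterate_add_apply, Function.iterate_add_apply]
  have h1 : (Config.step x r)^[1] ⟨.loop c p :: k, s, u, t₀⟩ =
      ⟨p :: .loop c p :: k, s, u, t₀ + c.cost x s + 1⟩ := by
    simp [Config.step, hc]
  rw [h1, hm, hm']
  simp only [add_assoc]

theorem Config.iterate_step_of_todo_eq_nil {c : Config V} (hc : c.todo = []) (m : ℕ) :
    (Config.step x r)^[m] c = c :=
  Function.iterate_fixed (by simp [Config.step, hc]) m

theorem Exec.halts {p : Cmd V} {s s' : V → ℝ} {u' t : ℕ} (h : Exec x r p s 0 s' u' t) :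
    Halts x r (start p s) := by
  obtain ⟨m, hm⟩ := h [] 0
  exact ⟨m, by rw [start, hm]⟩

/-- A final configuration is a fixed point of `Config.step`, so the first halting time and any later
time give the same configuration. -/
theorem Exec.final_eq {p : Cmd V} {s s' : V → ℝ} {u' t : ℕ} (h : Exec x r p s 0 s' u' t) :
    final x r (start p s) = ⟨[], s', u', t⟩ := by
  classical
  have hh := h.halts
  obtain ⟨m, hm⟩ := h [] 0
  rw [final, dif_pos hh]
  have hle : Nat.find hh ≤ m := Nat.find_min' hh (by rw [start, hm])
  obtain ⟨d, rfl⟩ := Nat.exists_eq_add_of_le' hle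
  rw [Function.iterate_add_apply] at hm
  rw [zero_add] at hm
  rw [← hm]
  change _ = (Config.step x r)^[d] ((Config.step x r)^[Nat.find hh] (start p s))
  rw [Config.iterate_step_of_todo_eq_nil (Nat.find_spec hh)]

end RealRAM

/-! ### The binary search and its execution by the program -/

namespace QuantileEst

open scoped Classical in
/-- One step of the binary search: `d` tells whether to move to the lower half. -/
noncomputable def bisect (d : ℕ → Prop) (p : ℕ × ℕ) : ℕ × ℕ :=
  if p.1 + 1 < p.2 then
    if d ((p.1 + p.2) / 2) then (p.1, (p.1 + p.2) / 2) else ((p.1 + p.2) / 2, p.2)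
  else p

/-- The search interval after `i` steps, when `d i m` is the decision of step `i` at `m`. -/
noncomputable def path (R : ℕ) (d : ℕ → ℕ → Prop) : ℕ → ℕ × ℕ
  | 0 => (0, R)
  | i + 1 => bisect (d i) (path R d i)

/-- The midpoint of the interval of the grid `u * L + ℤ * L` that contains `g`. -/
noncomputable def gridRound (L u g : ℝ) : ℝ := L * u + (⌊(g - L * u) / L⌋ + 1 / 2) * L

/-- The fraction of the samples that are at most `m`. -/
noncomputable def empCdf {n : ℕ} (S : Fin n → ℕ) (m : ℕ) : ℝ :=
  (Finset.univ.filter fun j => S j ≤ m).card / n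

/-- The width of the rounding grid, as the program computes it. -/
noncomputable def width (R : ℕ) (α ρ : ℝ) : ℝ :=
  6 * (α * ρ / (4 * Real.logb 2 R)) / (ρ / Real.logb 2 R)

/-- The registers hold the inputs and the search interval `p`. -/
structure Holds (R n : ℕ) (q α ρ : ℝ) (p : ℕ × ℕ) (s : Reg → ℝ) : Prop where
  R : s .R = R
  n : s .n = n
  q : s .q = q
  α : s .α = α
  ρ : s .ρ = ρ
  lo : s .lo = p.1
  hi : s .hi = p.2

/-- The number of samples at most `m` among the first `k`. -/
noncomputable def countUpTo {n : ℕ} (S : Fin n → ℕ) (m k : ℕ) : ℕ :=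
  (Finset.univ.filter fun j : Fin n => S j ≤ m ∧ j.1 < k).card

theorem countUpTo_succ {n : ℕ} (S : Fin n → ℕ) (m k : ℕ) (hk : k < n) :
    countUpTo S m (k + 1) = countUpTo S m k + if S ⟨k, hk⟩ ≤ m then 1 else 0 := by
  have h : (Finset.univ.filter fun j : Fin n => S j ≤ m ∧ j.1 < k + 1) =
      (Finset.univ.filter fun j : Fin n => S j ≤ m ∧ j.1 < k) ∪
        if S ⟨k, hk⟩ ≤ m then {⟨k, hk⟩} else ∅ := by
    ext j
    rcases lt_trichotomy j.1 k with h | h | h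
    · split_ifs <;> simp [h, Fin.ext_iff] <;> grind
    · obtain rfl : j = ⟨k, hk⟩ := Fin.ext h
      split_ifs <;> simp_all
    · split_ifs <;> simp [Fin.ext_iff] <;> grind
  rw [countUpTo, h, Finset.card_union_of_disjoint]
  · rw [countUpTo]; split_ifs <;> simp
  · split_ifs <;> simp

/-- The body of the counting loop of `empiricalCdf`. -/
def countBody : Cmd Reg :=
  .seq
    (.branch (.le (.read (.var .j)) (.var .mid))
      (.assign .cnt (.add (.var .cnt) (.lit 1)))
      .skip)
    (.assign .j (.add (.var .j) (.lit 1)))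

theorem exec_countBody {n : ℕ} (S : Fin n → ℕ) (r : ℕ → ℝ) (s : Reg → ℝ) (u m k : ℕ) (hk : k < n)
    (hj : s .j = k) (hm : s .mid = m) (hc : s .cnt = countUpTo S m k) :
    ∃ t ≤ 20, Exec (sampleArray S) r countBody s u
      (Function.update (Function.update s .cnt (countUpTo S m (k + 1))) .j ((k + 1 : ℕ) : ℝ)) u t := by
  have hread : sampleArray S ⌊s .j⌋₊ = S ⟨k, hk⟩ := by
    rw [hj, Nat.floor_natCast, sampleArray, dif_pos hk]
  by_cases hle : S ⟨k, hk⟩ ≤ m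
  · refine ⟨_, ?_, Exec.seq (Exec.branch_true ?_ (Exec.assign _ _ _ _))
      (Exec.assign_of_eq _ _ _ ?_)⟩
    rotate_left
    · simpa [Test.holds, Expr.eval, hread, hm] using hle
    · simp [Expr.eval, hj, hc, countUpTo_succ S m k hk, hle]
    · simp [Test.cost, Expr.cost]
  · refine ⟨_, ?_, Exec.seq (Exec.branch_false ?_ (Exec.skip _ _))
      (Exec.assign_of_eq _ _ _ ?_)⟩
    rotate_left
    · simpa [Test.holds, Expr.eval, hread, hm] using hle
    -- The sample is not counted, so the prescribed update of `cnt` changes nothing.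
    · have : Function.update s .cnt (countUpTo S m (k + 1) : ℝ) = s := by
        rw [Function.update_eq_self_iff, hc, countUpTo_succ S m k hk]; simp [hle]
      rw [this]
      simp [Expr.eval, hj]
    · simp [Test.cost, Expr.cost]

theorem exec_countLoop {n : ℕ} (S : Fin n → ℕ) (r : ℕ → ℝ) (u m : ℕ) (d : ℕ) :
    ∀ (s : Reg → ℝ) (k : ℕ), k + d = n → s .n = n → s .j = k → s .mid = m →
      s .cnt = countUpTo S m k →
    ∃ t ≤ 30 * d + 10, Exec (sampleArray S) r (.loop (.lt (.var .j) (.var .n)) countBody) s u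
      (Function.update (Function.update s .cnt (countUpTo S m n)) .j (n : ℝ)) u t := by
  induction d with
  | zero =>
    intro s k hk hn hj hm hc
    obtain rfl : k = n := by omega
    have : Function.update (Function.update s .cnt (countUpTo S m k : ℝ)) .j (k : ℝ) = s := by
      rw [← hc, ← hj]; simp
    rw [this]
    refine ⟨_, ?_, Exec.loop_false (by simp [Test.holds, Expr.eval, hn, hj])⟩
    simp [Test.cost, Expr.cost]
  | succ d ih =>
    intro s k hk hn hj hm hc
    obtain ⟨t, ht, h⟩ := exec_countBody S r s u m k (by omega) hj hm hc
    obtain ⟨t', ht', h'⟩ := ih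
      (Function.update (Function.update s .cnt (countUpTo S m (k + 1))) .j ((k + 1 : ℕ) : ℝ))
      (k + 1) (by omega) (by simpa using hn) (by simp) (by simpa using hm) (by simp)
    refine ⟨_, ?_, Exec.loop_true ?_ h (by convert h' using 1; ext v; cases v <;> simp)⟩
    · simp [Test.cost, Expr.cost]; omega
    · simp only [Test.holds, Expr.eval, hn, hj]; exact_mod_cast (by omega)

/-- The values left in `cnt` and `j` stay unspecified, since both registers are reset before they
are next read. -/
theorem exec_empiricalCdf {n : ℕ} (S : Fin n → ℕ) (r : ℕ → ℝ) (u m : ℕ) (s : Reg → ℝ)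
    (hn : s .n = n) (hm : s .mid = m) :
    ∃ t ≤ 30 * n + 30, ∃ c j : ℝ, Exec (sampleArray S) r empiricalCdf s u
      (Function.update (Function.update (Function.update s .cnt c) .j j) .Fmid (empCdf S m)) u t := by
  obtain ⟨t, ht, h⟩ := exec_countLoop S r u m n
    (Function.update (Function.update s .cnt 0) .j 0) 0 (by omega) (by simpa using hn) (by simp)
    (by simpa using hm) (by simp [countUpTo])
  refine ⟨_, ?_, countUpTo S m n, n, Exec.seq (Exec.assign _ _ _ _) (Exec.seq (Exec.assign _ _ _ _)
    (Exec.seq (by simp only [Expr.eval, Nat.cast_zero]; exact h) (Exec.assign_of_eq _ _ _ ?_)))⟩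
  rotate_left
  · have : countUpTo S m n = (Finset.univ.filter fun j => S j ≤ m).card := by simp [countUpTo]
    ext v; cases v <;> simp [Expr.eval, hn, empCdf, this]
  · simp [Expr.cost]; omega

/-- The decision of the binary search: whether the rounded value of `g` is at least `q`. -/
def Lower (q L u g : ℝ) : Prop := q ≤ gridRound L u g

/-- The decisions of the algorithm when the values `F m` are rounded, at step `i` with offset
`r i`. -/
def decision (q L : ℝ) (F : ℕ → ℝ) (r : ℕ → ℝ) (i m : ℕ) : Prop := Lower q L (r i) (F m)

/-- The body of the search loop of `rQuantileEst`. -/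
def searchBody : Cmd Reg :=
  .seq (.assign .mid (.floor (.div (.add (.var .lo) (.var .hi)) (.lit 2)))) <|
  .seq empiricalCdf <|
  .seq (rRound (.var .Fmid) acc rep) <|
  .branch (.le (.var .q) (.var .Fround))
    (.assign .hi (.var .mid))
    (.assign .lo (.var .mid))

theorem exec_rRound (x r : ℕ → ℝ) (u : ℕ) (s : Reg → ℝ) (L : ℝ)
    (hL : 6 * (s .α * s .ρ / (4 * Real.logb 2 (s .R))) / (s .ρ / Real.logb 2 (s .R)) = L) :
    ∃ t ≤ 100 + Nat.size ⌊(s .Fmid - L * r u) / L⌋.natAbs,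
      Exec x r (rRound (.var .Fmid) acc rep) s u
        (Function.update (Function.update (Function.update s .L L) .off (L * r u)) .Fround
          (gridRound L (r u) (s .Fmid))) (u + 1) t := by
  refine ⟨_, ?_, Exec.seq (Exec.assign_of_eq (s' := Function.update s .L L) _ _ _ ?_)
    (Exec.seq (Exec.uniform _ _ _ _) (Exec.assign_of_eq _ _ _ ?_))⟩
  rotate_left
  · simp [Expr.eval, acc, rep, hL]
  · simp [Expr.eval, gridRound]
  · simp [Expr.cost, Expr.eval, acc, rep]; omega

section Execution

variable {R n : ℕ} {q α ρ : ℝ} {p : ℕ × ℕ} {s : Reg → ℝ}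

theorem exec_searchBody (S : Fin n → ℕ) (r : ℕ → ℝ) (u : ℕ) (hs : Holds R n q α ρ p s)
    (hp : p.1 + 1 < p.2) :
    ∃ (s' : Reg → ℝ) (t : ℕ),
      Holds R n q α ρ (bisect (decision q (width R α ρ) (empCdf S) r u) p) s' ∧
      t ≤ 30 * n + 170 + Nat.size ((p.1 + p.2) / 2) +
        Nat.size ⌊(empCdf S ((p.1 + p.2) / 2) - width R α ρ * r u) / width R α ρ⌋.natAbs ∧
      Exec (sampleArray S) r searchBody s u s' (u + 1) t := by
  set m := (p.1 + p.2) / 2 with hm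
  have hfl : ⌊((p.1 : ℝ) + p.2) / 2⌋ = (m : ℤ) := by
    have : ⌊(((p.1 + p.2 : ℕ) : ℝ)) / ((2 : ℕ) : ℝ)⌋₊ = m := Nat.floor_div_eq_div _ _
    push_cast at this
    rw [← Int.natCast_floor_eq_floor (by positivity), this]
  obtain ⟨t₁, ht₁, c, j, h₁⟩ := exec_empiricalCdf S r u m (Function.update s .mid m)
    (by simpa using hs.n) (by simp)
  set s₁ := Function.update (Function.update (Function.update (Function.update s .mid (m : ℝ))
    .cnt c) .j j) .Fmid (empCdf S m) with hs₁
  obtain ⟨t₂, ht₂, h₂⟩ := exec_rRound (sampleArray S) r u s₁ (width R α ρ)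
    (by simp [hs₁, hs.α, hs.ρ, hs.R, width])
  set s₂ := Function.update (Function.update (Function.update s₁ .L (width R α ρ)) .off
    (width R α ρ * r u)) .Fround (gridRound (width R α ρ) (r u) (s₁ .Fmid)) with hs₂
  have hF : s₁ .Fmid = empCdf S m := by simp [hs₁]
  rw [hF] at ht₂
  have h₀ : Exec (sampleArray S) r (.assign .mid (.floor (.div (.add (.var .lo) (.var .hi))
      (.lit 2)))) s u (Function.update s .mid (m : ℝ)) u _ :=
    Exec.assign_of_eq _ _ _ (by simp [Expr.eval, hs.lo, hs.hi, hfl])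
  have hc : Expr.cost (sampleArray S) s (.floor (.div (.add (.var .lo) (.var .hi)) (.lit 2))) =
      6 + m.size := by
    simp [Expr.cost, Expr.eval, hs.lo, hs.hi, hfl]
  by_cases hd : decision q (width R α ρ) (empCdf S) r u m
  · refine ⟨_, _, ?_, ?_, Exec.seq h₀ (Exec.seq h₁ (Exec.seq h₂ (Exec.branch_true ?_
      (Exec.assign _ _ _ _))))⟩
    · rw [bisect, if_pos hp, if_pos hd]
      constructor <;> simp [Expr.eval, hs₂, hs₁, hs.R, hs.n, hs.q, hs.α, hs.ρ, hs.lo, hm]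
    · rw [hc]; simp [Expr.cost, Test.cost]; omega
    · simpa [Test.holds, Expr.eval, hs₂, hs₁, hs.q, decision, Lower] using hd
  · refine ⟨_, _, ?_, ?_, Exec.seq h₀ (Exec.seq h₁ (Exec.seq h₂ (Exec.branch_false ?_
      (Exec.assign _ _ _ _))))⟩
    · rw [bisect, if_pos hp, if_neg hd]
      constructor <;> simp [Expr.eval, hs₂, hs₁, hs.R, hs.n, hs.q, hs.α, hs.ρ, hs.hi, hm]
    · rw [hc]; simp [Expr.cost, Test.cost]; omega
    · simpa [Test.holds, Expr.eval, hs₂, hs₁, hs.q, decision, Lower] using hd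

theorem bisect_of_not_lt (d : ℕ → Prop) (h : ¬ p.1 + 1 < p.2) : bisect d p = p := if_neg h

/-- The larger half of an interval of length `l` has length `⌈l / 2⌉`; powers of two absorb the
rounding up. -/
theorem bisect_sub_le (d : ℕ → Prop) (k : ℕ) (h : p.2 - p.1 ≤ 2 ^ (k + 1)) :
    (bisect d p).2 - (bisect d p).1 ≤ 2 ^ k := by
  rw [pow_succ] at h
  have := Nat.one_le_two_pow (n := k)
  unfold bisect
  split_ifs <;> (try dsimp only) <;> omega

theorem path_sub_le (d : ℕ → ℕ → Prop) {K : ℕ} (hK : R ≤ 2 ^ K) (i : ℕ) (hi : i ≤ K) :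
    (path R d i).2 - (path R d i).1 ≤ 2 ^ (K - i) := by
  induction i with
  | zero => simpa [path] using hK
  | succ i ih =>
    refine bisect_sub_le _ _ ?_
    rw [show K - (i + 1) + 1 = K - i by omega]
    exact ih (by omega)

theorem path_bounds (hR : 1 ≤ R) (d : ℕ → ℕ → Prop) (i : ℕ) :
    (path R d i).1 < (path R d i).2 ∧ (path R d i).2 ≤ R := by
  induction i with
  | zero => exact ⟨hR, le_rfl⟩
  | succ i ih =>
    rw [path, bisect]
    split_ifs <;> (try dsimp only) <;> omega

theorem path_clog (hR : 1 ≤ R) (d : ℕ → ℕ → Prop) :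
    (path R d (Nat.clog 2 R)).2 = (path R d (Nat.clog 2 R)).1 + 1 := by
  have h := path_sub_le (R := R) d (Nat.le_pow_clog one_lt_two R) _ le_rfl
  have h' := path_bounds hR d (Nat.clog 2 R)
  simp only [Nat.sub_self, pow_zero] at h
  omega

/-- The program leaves its loop once the interval has length one, while `path` idles from then on.
Hence its value at the fixed time `Nat.clog 2 R` describes the end of every run. -/
theorem path_of_not_lt (d : ℕ → ℕ → Prop) (i k : ℕ)
    (h : ¬ (path R d i).1 + 1 < (path R d i).2) : path R d (i + k) = path R d i := by
  induction k with
  | zero => rfl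
  | succ k ih => rw [← add_assoc, path, ih, bisect_of_not_lt _ h]

/-- The step number equals the number of random draws used, so step `i` rounds with `r i`. The bound
`B` on bit lengths is a premise of the time estimate only: termination and output hold for arbitrary
tapes. -/
theorem exec_searchLoop (hR : 1 ≤ R) (S : Fin n → ℕ) (r : ℕ → ℝ) (B : ℕ) (k : ℕ) :
    ∀ (s : Reg → ℝ) (i : ℕ), i + k = Nat.clog 2 R →
      Holds R n q α ρ (path R (decision q (width R α ρ) (empCdf S) r) i) s →
    ∃ (s' : Reg → ℝ) (u' t : ℕ),
      Holds R n q α ρ (path R (decision q (width R α ρ) (empCdf S) r) (Nat.clog 2 R)) s' ∧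
      ((∀ i m, m ≤ R → Nat.size m +
        Nat.size ⌊(empCdf S m - width R α ρ * r i) / width R α ρ⌋.natAbs ≤ B) →
        t ≤ k * (30 * n + 180 + B) + 10) ∧
      Exec (sampleArray S) r
        (.loop (.lt (.var .lo) (.sub (.var .hi) (.lit 1))) searchBody) s i s' u' t := by
  set d := decision q (width R α ρ) (empCdf S) r with hd
  have hcond : ∀ (s : Reg → ℝ) (p : ℕ × ℕ), Holds R n q α ρ p s →
      ((Test.lt (.var .lo) (.sub (.var .hi) (.lit 1))).holds (sampleArray S) s ↔
        p.1 + 1 < p.2) := by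
    intro s p hs
    simp only [Test.holds, Expr.eval, hs.lo, hs.hi, lt_sub_iff_add_lt]
    norm_cast
  have hexit : ∀ (s : Reg → ℝ) (i k : ℕ), i + k = Nat.clog 2 R → Holds R n q α ρ (path R d i) s →
      ¬ (path R d i).1 + 1 < (path R d i).2 →
      ∃ (s' : Reg → ℝ) (u' t : ℕ), Holds R n q α ρ (path R d (Nat.clog 2 R)) s' ∧ t ≤ 10 ∧
      Exec (sampleArray S) r
        (.loop (.lt (.var .lo) (.sub (.var .hi) (.lit 1))) searchBody) s i s' u' t := by
    intro s i k hi hs hn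
    refine ⟨s, i, _, ?_, ?_, Exec.loop_false (by rwa [hcond s _ hs])⟩
    · rwa [← hi, path_of_not_lt _ _ _ hn]
    · simp [Test.cost, Expr.cost]
  induction k with
  | zero =>
    intro s i hi hs
    obtain ⟨s', u', t, h, ht, he⟩ := hexit s i 0 hi hs (by
      obtain rfl : i = Nat.clog 2 R := by omega
      rw [path_clog hR]; simp)
    exact ⟨s', u', t, h, fun _ => by omega, he⟩
  | succ k ih =>
    intro s i hi hs
    by_cases hp : (path R d i).1 + 1 < (path R d i).2
    · obtain ⟨s₁, t₁, hs₁, ht₁, he₁⟩ := exec_searchBody S r i hs hp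
      obtain ⟨s₂, u₂, t₂, hs₂, ht₂, he₂⟩ := ih s₁ (i + 1) (by omega) hs₁
      refine ⟨s₂, u₂, _, hs₂, fun hB => ?_, Exec.loop_true ((hcond s _ hs).2 hp) he₁ he₂⟩
      have h₁ := hB i (((path R d i).1 + (path R d i).2) / 2)
        (by have := path_bounds hR d i; omega)
      have h₂ := ht₂ hB
      simp only [Test.cost, Expr.cost, add_mul]
      omega
    · obtain ⟨s', u', t, h, ht, he⟩ := hexit s i _ hi hs hp
      exact ⟨s', u', t, h, fun _ => by omega, he⟩

theorem exec_rQuantileEst (hR : 1 ≤ R) (q α ρ β : ℝ) (S : Fin n → ℕ) (r : ℕ → ℝ) (B : ℕ) :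
    ∃ (s' : Reg → ℝ) (u' t : ℕ),
      Holds R n q α ρ (path R (decision q (width R α ρ) (empCdf S) r) (Nat.clog 2 R)) s' ∧
      ((∀ i m, m ≤ R → Nat.size m +
        Nat.size ⌊(empCdf S m - width R α ρ * r i) / width R α ρ⌋.natAbs ≤ B) →
        t ≤ Nat.clog 2 R * (30 * n + 180 + B) + 20) ∧
      Exec (sampleArray S) r rQuantileEst (inputs R n q α ρ β) 0 s' u' t := by
  obtain ⟨s', u', t, h, ht, he⟩ := exec_searchLoop (q := q) (α := α) (ρ := ρ) hR S r B
    (Nat.clog 2 R)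
    (Function.update (Function.update (inputs R n q α ρ β) .lo 0) .hi R) 0 (by omega)
    (by constructor <;> simp [inputs, path])
  refine ⟨s', u', _, h, fun hB => ?_, Exec.seq (Exec.assign _ _ _ _)
    (Exec.seq (Exec.assign_of_eq _ _ _ ?_) he)⟩
  · have := ht hB
    simp [Expr.cost]; omega
  · simp [Expr.eval, inputs]

theorem terminates (hR : 1 ≤ R) (q α ρ β : ℝ) (S : Fin n → ℕ) (r : ℕ → ℝ) :
    Terminates R q α ρ β S r := by
  obtain ⟨_, _, _, _, _, h⟩ := exec_rQuantileEst hR q α ρ β S r 0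
  exact h.halts

theorem output_eq (hR : 1 ≤ R) (q α ρ β : ℝ) (S : Fin n → ℕ) (r : ℕ → ℝ) :
    output R q α ρ β S r =
      (path R (decision q (width R α ρ) (empCdf S) r) (Nat.clog 2 R)).2 := by
  obtain ⟨_, _, _, h, _, he⟩ := exec_rQuantileEst hR q α ρ β S r 0
  rw [output, finalConfig, he.final_eq]
  exact h.hi

theorem runningTime_le (hR : 1 ≤ R) (q α ρ β : ℝ) (S : Fin n → ℕ) (r : ℕ → ℝ) (B : ℕ)
    (hB : ∀ i m, m ≤ R → Nat.size m +
      Nat.size ⌊(empCdf S m - width R α ρ * r i) / width R α ρ⌋.natAbs ≤ B) :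
    runningTime R q α ρ β S r ≤ Nat.clog 2 R * (30 * n + 180 + B) + 20 := by
  obtain ⟨_, _, _, _, ht, he⟩ := exec_rQuantileEst hR q α ρ β S r B
  rw [runningTime, finalConfig, he.final_eq]
  exact ht hB

end Execution

/-! ### Consequences of the sample size, and the running time -/

theorem one_le_logb_natCast {R : ℕ} (hR : 2 ≤ R) : 1 ≤ Real.logb 2 R := by
  rw [Real.le_logb_iff_rpow_le one_lt_two (by positivity)]
  simpa using (by exact_mod_cast hR : (2 : ℝ) ≤ R)

theorem width_eq {R : ℕ} (hR : 2 ≤ R) (α : ℝ) {ρ : ℝ} (hρ : 0 < ρ) : width R α ρ = 3 / 2 * α := by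
  have := one_le_logb_natCast hR
  have : Real.logb 2 R ≠ 0 := by positivity
  rw [width]
  field_simp
  ring

theorem one_le_log_two_div {β ρ : ℝ} (hρ : ρ < 1) (hβ : β ∈ Set.Ioo 0 (ρ / 3)) :
    1 ≤ Real.log (2 / β) := by
  rw [Real.le_log_iff_exp_le (div_pos two_pos hβ.1), le_div_iff₀ hβ.1]
  nlinarith [Real.exp_one_lt_d9, hβ.1, hβ.2]

theorem sampleSize_eq (R : ℕ) (α ρ β : ℝ) :
    sampleSize R α ρ β = 8 * (Real.logb 2 R / (α * ρ)) ^ 2 * Real.log (2 / β) := by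
  rw [sampleSize, div_pow, mul_pow]
  ring

theorem sq_le_sampleSize {R : ℕ} {α ρ β : ℝ} (hρ : ρ < 1) (hβ : β ∈ Set.Ioo 0 (ρ / 3)) :
    8 * (Real.logb 2 R / (α * ρ)) ^ 2 ≤ sampleSize R α ρ β := by
  rw [sampleSize_eq]
  exact le_mul_of_one_le_right (by positivity) (one_le_log_two_div hρ hβ)

theorem sampleSize_le {R : ℕ} {α ρ β : ℝ} (hρ : ρ < 1) (hβ : β ∈ Set.Ioo 0 (ρ / 3)) :
    sampleSize R α ρ β ≤ 16 * (Real.logb 2 R ^ 2 / (α ^ 2 * ρ ^ 2) * Real.log (1 / β)) := by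
  -- This is `2 / β ≤ (1 / β) ^ 2`, which holds because `β < 1 / 3`.
  have h : Real.log (2 / β) ≤ 2 * Real.log (1 / β) := by
    rw [← Real.log_rpow (by simpa using hβ.1)]
    refine Real.log_le_log (div_pos two_pos hβ.1) ?_
    norm_cast
    rw [div_pow, div_le_div_iff₀ hβ.1 (by have := hβ.1; positivity)]
    nlinarith [hβ.1, hβ.2]
  rw [sampleSize_eq, div_pow, mul_pow]
  have := mul_le_mul_of_nonneg_left h
    (show 0 ≤ 8 * (Real.logb 2 R ^ 2 / (α ^ 2 * ρ ^ 2)) by positivity)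
  linarith

section Parameters

variable {R n : ℕ} {α ρ β : ℝ}

theorem sq_le_of_sampleSize_le (hρ : ρ < 1) (hβ : β ∈ Set.Ioo 0 (ρ / 3))
    (hn : sampleSize R α ρ β ≤ n) : 8 * (Real.logb 2 R / (α * ρ)) ^ 2 ≤ n :=
  (sq_le_sampleSize hρ hβ).trans hn

theorem logb_le_div (hR : 1 ≤ R) (hα : α ∈ Set.Ioo 0 1) (hρ : ρ ∈ Set.Ioo 0 1) :
    Real.logb 2 R ≤ Real.logb 2 R / (α * ρ) := by
  have h0 : 0 ≤ Real.logb 2 R := Real.logb_nonneg one_lt_two (by exact_mod_cast hR)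
  rw [le_div_iff₀ (mul_pos hα.1 hρ.1)]
  exact mul_le_of_le_one_right h0 (mul_le_one₀ hα.2.le hρ.1.le hρ.2.le)

/-- Bounds the grid index computed by the rounding, which is of order `α⁻¹`, and shows that there is
at least one sample. -/
theorem inv_le_of_sampleSize_le (hR : 2 ≤ R) (hα : α ∈ Set.Ioo 0 1) (hρ : ρ ∈ Set.Ioo 0 1)
    (hβ : β ∈ Set.Ioo 0 (ρ / 3)) (hn : sampleSize R α ρ β ≤ n) : α⁻¹ + 1 ≤ n := by
  have h := sq_le_of_sampleSize_le hρ.2 hβ hn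
  have h1 : α⁻¹ ≤ Real.logb 2 R / (α * ρ) := by
    rw [inv_eq_one_div, div_le_div_iff₀ hα.1 (mul_pos hα.1 hρ.1), one_mul]
    nlinarith [one_le_logb_natCast hR, mul_pos hα.1 hρ.1, mul_lt_mul_of_pos_left hρ.2 hα.1,
      mul_le_mul_of_nonneg_right (one_le_logb_natCast hR) hα.1.le]
  have h2 : 1 ≤ α⁻¹ := (one_le_inv₀ hα.1).2 hα.2.le
  nlinarith

theorem le_two_pow_of_sampleSize_le (hR : 1 ≤ R) (hα : α ∈ Set.Ioo 0 1) (hρ : ρ ∈ Set.Ioo 0 1)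
    (hβ : β ∈ Set.Ioo 0 (ρ / 3)) (hn : sampleSize R α ρ β ≤ n) : R ≤ 2 ^ n := by
  obtain rfl | hR' := hR.eq_or_lt
  · exact Nat.one_le_two_pow
  have h := sq_le_of_sampleSize_le hρ.2 hβ hn
  have h1 := logb_le_div hR hα hρ
  have h2 := one_le_logb_natCast hR'
  have h3 : Real.logb 2 R ≤ n := by nlinarith
  rw [Real.logb_le_iff_le_rpow one_lt_two (by positivity)] at h3
  exact_mod_cast h3

theorem clog_le_two_mul_logb (hR : 2 ≤ R) : (Nat.clog 2 R : ℝ) ≤ 2 * Real.logb 2 R := by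
  have h := Nat.pow_pred_clog_lt_self one_lt_two (show 1 < R by omega)
  have h1 : ((Nat.clog 2 R).pred : ℝ) ≤ Real.logb 2 R := by
    rw [Real.le_logb_iff_rpow_le one_lt_two (by positivity), Real.rpow_natCast]
    exact_mod_cast h.le
  have h2 : (Nat.clog 2 R : ℝ) ≤ (Nat.clog 2 R).pred + 1 := by
    have : Nat.clog 2 R ≤ (Nat.clog 2 R).pred + 1 := by rw [Nat.pred_eq_sub_one]; omega
    exact_mod_cast this
  linarith [one_le_logb_natCast hR]

theorem empCdf_mem_Icc (S : Fin n → ℕ) (m : ℕ) : empCdf S m ∈ Set.Icc (0 : ℝ) 1 := by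
  refine ⟨by unfold empCdf; positivity, div_le_one_of_le₀ ?_ (by positivity)⟩
  exact_mod_cast (Finset.card_le_univ _).trans_eq (Fintype.card_fin n)

theorem runningTime_le_quadratic (hR : 1 ≤ R) (hα : α ∈ Set.Ioo 0 1) (hρ : ρ ∈ Set.Ioo 0 1)
    (hβ : β ∈ Set.Ioo 0 (ρ / 3)) (hn : sampleSize R α ρ β ≤ n) (q : ℝ) (S : Fin n → ℕ) (r : ℕ → ℝ)
    (hr : ∀ i, r i ∈ Set.Ico (0 : ℝ) 1) :
    runningTime R q α ρ β S r ≤ 32 * n ^ 2 + 181 * n + 20 := by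
  have hRn := le_two_pow_of_sampleSize_le hR hα hρ hβ hn
  -- Bit lengths: `n + 1` for a midpoint `m ≤ R ≤ 2 ^ n`, and `n` for the grid index.
  refine (runningTime_le hR q α ρ β S r (2 * n + 1) fun i m hm => ?_).trans ?_
  · have h1 : Nat.size m ≤ n + 1 := by
      rw [Nat.size_le, pow_succ]
      have := Nat.one_le_two_pow (n := n)
      omega
    have h2 : Nat.size ⌊(empCdf S m - width R α ρ * r i) / width R α ρ⌋.natAbs ≤ n := by
      obtain rfl | hR' := hR.eq_or_lt
      -- For `R = 1` the logarithm is zero, so division by zero gives width zero and grid index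
      -- zero.
      · simp [width]
      refine Nat.size_le.2 (lt_of_le_of_lt ?_ Nat.lt_two_pow_self)
      have hn' := inv_le_of_sampleSize_le hR' hα hρ hβ hn
      obtain ⟨h0, h1⟩ := empCdf_mem_Icc S m
      have hα0 := hα.1
      rw [width_eq hR' α hρ.1, sub_div, mul_div_cancel_left₀ _ (by positivity)]
      have h3 : empCdf S m / (3 / 2 * α) ≤ α⁻¹ := by
        rw [inv_eq_one_div, div_le_div_iff₀ (by positivity) hα0]
        nlinarith
      have h4 : 0 ≤ empCdf S m / (3 / 2 * α) := by positivity
      have h5 : 0 < α⁻¹ := inv_pos.2 hα0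
      have h6 : -(n : ℤ) ≤ ⌊empCdf S m / (3 / 2 * α) - r i⌋ := by
        rw [Int.le_floor]
        push_cast
        linarith [(hr i).2]
      have h7 : ⌊empCdf S m / (3 / 2 * α) - r i⌋ ≤ (n : ℤ) := by
        have : ⌊empCdf S m / (3 / 2 * α) - r i⌋ ≤ ((n : ℤ) : ℝ) :=
          (Int.floor_le _).trans (by push_cast; linarith [(hr i).1])
        exact_mod_cast this
      omega
    omega
  · have h : Nat.clog 2 R ≤ n := Nat.clog_le_of_le_pow hRn
    nlinarith

end Parameters

/-! ### Rounding to a random grid -/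

theorem abs_gridRound_sub_le {L : ℝ} (hL : 0 < L) (u g : ℝ) : |gridRound L u g - g| ≤ L / 2 := by
  have h1 := Int.floor_le ((g - L * u) / L)
  have h2 := Int.lt_floor_add_one ((g - L * u) / L)
  rw [le_div_iff₀ hL] at h1
  rw [div_lt_iff₀ hL] at h2
  rw [abs_le, gridRound]
  constructor <;> linarith

theorem unif_floor_ne_le (a b : ℝ) :
    unif {u | ⌊a - u⌋ ≠ ⌊b - u⌋} ≤ ENNReal.ofReal |a - b| := by
  wlog hab : a ≤ b generalizing a b
  · rw [abs_sub_comm]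
    simpa only [ne_comm] using this b a (le_of_not_ge hab)
  rw [abs_sub_comm, abs_of_nonneg (sub_nonneg.2 hab)]
  by_cases h1 : 1 ≤ b - a
  · exact prob_le_one.trans (by simpa using h1)
  have hk := Int.floor_le b
  have hk' := Int.lt_floor_add_one b
  set k := ⌊b⌋ with hkdef
  rw [unif, Measure.restrict_apply' measurableSet_Ico]
  -- Some integer `j ≤ k` satisfies `a - u < j ≤ b - u`; the two sets cover `j = k` and `j < k`. If
  -- `a < k` their lengths are `b - k` and `k - a`; otherwise the second is empty and the first has
  -- length `b - a`.
  have hsub : {u | ⌊a - u⌋ ≠ ⌊b - u⌋} ∩ Set.Ico 0 1 ⊆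
      Set.Icc (max 0 (a - k)) (b - k) ∪ Set.Ioo (a - k + 1) 1 := by
    rintro u ⟨hu, hu0, hu1⟩
    have hlt : ⌊a - u⌋ < ⌊b - u⌋ := lt_of_le_of_ne (Int.floor_mono (by linarith)) hu
    rw [Int.floor_lt] at hlt
    have hle := Int.floor_le (b - u)
    set j := ⌊b - u⌋
    have hjk : j ≤ k := Int.floor_mono (by linarith)
    obtain hjk' | hjk' := hjk.eq_or_lt
    · rw [hjk'] at hlt hle
      exact Or.inl ⟨max_le hu0 (by linarith), by linarith⟩
    · have : (j : ℝ) + 1 ≤ k := by exact_mod_cast hjk'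
      exact Or.inr ⟨by linarith, hu1⟩
  refine (measure_mono hsub).trans ((measure_union_le _ _).trans ?_)
  rw [Real.volume_Icc, Real.volume_Ioo]
  rcases le_total 0 (a - k) with h | h
  · rw [max_eq_right h, ENNReal.ofReal_of_nonpos (p := 1 - (a - k + 1)) (by linarith), add_zero]
    exact ENNReal.ofReal_le_ofReal (by linarith)
  · rw [max_eq_left h, ← ENNReal.ofReal_add (by linarith) (by linarith)]
    exact ENNReal.ofReal_le_ofReal (by linarith)

/-- The decision depends on `g` only through the index `⌊g / L - u⌋` of its grid cell. -/
theorem unif_lower_ne_le (q : ℝ) {L : ℝ} (hL : 0 < L) (g g' : ℝ) :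
    unif {u | ¬ (Lower q L u g ↔ Lower q L u g')} ≤ ENNReal.ofReal (|g - g'| / L) := by
  have h : {u | ¬ (Lower q L u g ↔ Lower q L u g')} ⊆ {u | ⌊g / L - u⌋ ≠ ⌊g' / L - u⌋} := by
    intro u hu hf
    refine hu ?_
    have hg : ∀ g : ℝ, (g - L * u) / L = g / L - u := fun g => by field_simp
    rw [Lower, Lower, gridRound, gridRound, hg, hg, hf]
  refine (measure_mono h).trans ((unif_floor_ne_le _ _).trans_eq ?_)
  rw [← sub_div, abs_div, abs_of_pos hL]

theorem measurableSet_lower (q L g : ℝ) : MeasurableSet {u | Lower q L u g} := by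
  unfold Lower gridRound
  exact measurableSet_le measurable_const (by fun_prop)

/-! ### Deviation of the empirical CDF -/

open ProbabilityTheory

instance {X : Type*} [MeasurableSpace X] (D : Measure X) [IsProbabilityMeasure D] (n : ℕ) :
    IsProbabilityMeasure (samplesLaw D n) := by
  unfold samplesLaw; infer_instance

instance : IsProbabilityMeasure tapeLaw := by
  unfold tapeLaw; infer_instance

section Sampling

/-- The indicator of `{0, …, m}`. -/
noncomputable def indLe (m : ℕ) : ℕ → ℝ := (Set.Iic m).indicator 1

theorem indLe_mem_Icc (m k : ℕ) : indLe m k ∈ Set.Icc (0 : ℝ) 1 := by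
  unfold indLe Set.indicator
  split_ifs <;> simp

theorem empCdf_eq_sum {n : ℕ} (S : Fin n → ℕ) (m : ℕ) :
    empCdf S m = (∑ j, indLe m (S j)) / n := by
  simp [empCdf, indLe, Set.indicator]

theorem integral_indLe (D : Measure ℕ) (m : ℕ) : ∫ k, indLe m k ∂D = distCdf D m := by
  rw [indLe, integral_indicator_one (measurableSet_Iic), distCdf]

variable (D : Measure ℕ) [IsProbabilityMeasure D]

theorem memLp_indLe (m : ℕ) : MemLp (indLe m) 2 D :=
  memLp_of_bounded (a := 0) (b := 1) (.of_forall (indLe_mem_Icc m))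
    (measurable_of_countable _).aestronglyMeasurable _

theorem integral_indLe_eval (n m : ℕ) (j : Fin n) :
    ∫ S, indLe m (S j) ∂samplesLaw D n = distCdf D m := by
  rw [← integral_indLe, samplesLaw]
  exact integral_comp_eval (μ := fun _ : Fin n => D) (i := j) (f := indLe m)
    (measurable_of_countable _).aestronglyMeasurable

theorem integrable_indLe_eval (n m : ℕ) (j : Fin n) :
    Integrable (fun S : Fin n → ℕ => indLe m (S j)) (samplesLaw D n) :=
  .of_mem_Icc 0 1 (measurable_of_countable _).aemeasurable (.of_forall fun _ => indLe_mem_Icc _ _)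

theorem integral_empCdf {n : ℕ} (hn : 0 < n) (m : ℕ) :
    ∫ S, empCdf S m ∂samplesLaw D n = distCdf D m := by
  simp only [empCdf_eq_sum]
  rw [integral_div, integral_finsetSum _ fun j _ => integrable_indLe_eval D n m j]
  simp only [integral_indLe_eval, Finset.sum_const, Finset.card_univ, Fintype.card_fin,
    nsmul_eq_mul]
  field_simp

theorem memLp_empCdf (n m : ℕ) : MemLp (fun S : Fin n → ℕ => empCdf S m) 2 (samplesLaw D n) :=
  memLp_of_bounded (a := 0) (b := 1) (.of_forall fun _ => empCdf_mem_Icc _ _)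
    (measurable_of_countable _).aestronglyMeasurable _

/-- The variances of independent indicators add up, and a variable in `[0, 1]` has variance at most
`1 / 4`. -/
theorem variance_empCdf_le {n : ℕ} (hn : 0 < n) (m : ℕ) :
    Var[fun S : Fin n → ℕ => empCdf S m; samplesLaw D n] ≤ 1 / (4 * n) := by
  have h : (fun S : Fin n → ℕ => empCdf S m) =
      fun S => (n : ℝ)⁻¹ * (∑ j : Fin n, fun S : Fin n → ℕ => indLe m (S j)) S := by
    ext S
    rw [empCdf_eq_sum, Finset.sum_apply, div_eq_inv_mul]
  rw [h, variance_const_mul, samplesLaw,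
    variance_sum_pi (X := fun _ : Fin n => indLe m) fun _ => memLp_indLe D m]
  have hv : Var[indLe m; D] ≤ ((1 - 0) / 2) ^ 2 :=
    variance_le_sq_of_bounded (.of_forall (indLe_mem_Icc m)) (measurable_of_countable _).aemeasurable
  simp only [Finset.sum_const, Finset.card_univ, Fintype.card_fin, nsmul_eq_mul]
  have hn' : (0 : ℝ) < n := by exact_mod_cast hn
  rw [show (1 : ℝ) / (4 * n) = (n : ℝ)⁻¹ ^ 2 * (n * ((1 - 0) / 2) ^ 2) by field_simp; norm_num]
  gcongr

/-- Nonnegativity of the variance of `|X|` gives `(E|X|)² ≤ E X²`, here with `X` the centred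
empirical CDF. -/
theorem integral_abs_empCdf_sub_le {n : ℕ} (hn : 0 < n) (m : ℕ) :
    ∫ S, |empCdf S m - distCdf D m| ∂samplesLaw D n ≤ 1 / (2 * √n) := by
  have hn' : (0 : ℝ) < n := by exact_mod_cast hn
  have hm : MemLp (fun S : Fin n → ℕ => |empCdf S m - distCdf D m|) 2 (samplesLaw D n) :=
    ((memLp_empCdf D n m).sub (memLp_const _)).abs
  have h := variance_eq_sub hm
  have h0 := variance_nonneg (fun S : Fin n → ℕ => |empCdf S m - distCdf D m|) (samplesLaw D n)
  have hv := variance_empCdf_le D hn m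
  rw [variance_eq_integral (measurable_of_countable _).aemeasurable, integral_empCdf D hn] at hv
  simp only [Pi.pow_apply, sq_abs] at h
  refine le_of_sq_le_sq ?_ (by positivity)
  rw [div_pow, mul_pow, Real.sq_sqrt hn'.le]
  norm_num at hv ⊢
  linarith

theorem lintegral_abs_empCdf_sub_le {n : ℕ} (hn : 0 < n) (m : ℕ) {L : ℝ} (hL : 0 < L) :
    ∫⁻ S, ENNReal.ofReal (|empCdf S m - distCdf D m| / L) ∂samplesLaw D n ≤
      ENNReal.ofReal (1 / (2 * √n * L)) := by
  rw [← ofReal_integral_eq_lintegral_ofReal, integral_div]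
  · refine ENNReal.ofReal_le_ofReal ?_
    rw [← div_div]
    exact div_le_div_of_nonneg_right (integral_abs_empCdf_sub_le D hn m) hL.le
  · exact ((((memLp_empCdf D n m).sub (memLp_const _)).abs).integrable (by norm_num)).div_const _
  · exact .of_forall fun _ => by positivity

/-- Hoeffding's inequality: centred indicators are sub-Gaussian with parameter `1 / 4`, and the
one-sided bound is applied to the sum and to its negative. -/
theorem measure_abs_empCdf_sub_gt_le {n : ℕ} (hn : 0 < n) (m : ℕ) {ε : ℝ} (hε : 0 ≤ ε) :
    (samplesLaw D n).real {S | ε < |empCdf S m - distCdf D m|} ≤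
      2 * Real.exp (-(2 * n * ε ^ 2)) := by
  have hn' : (0 : ℝ) < n := by exact_mod_cast hn
  have hsub : ∀ j : Fin n, HasSubgaussianMGF
      (fun S : Fin n → ℕ => indLe m (S j) - distCdf D m) ((‖(1 : ℝ) - 0‖₊ / 2) ^ 2)
      (samplesLaw D n) := by
    intro j
    have := hasSubgaussianMGF_of_mem_Icc (μ := samplesLaw D n) (a := 0) (b := 1)
      (X := fun S : Fin n → ℕ => indLe m (S j)) (measurable_of_countable _).aemeasurable
      (.of_forall fun _ => indLe_mem_Icc _ _)
    rwa [integral_indLe_eval] at this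
  have hind : iIndepFun (fun (j : Fin n) (S : Fin n → ℕ) => indLe m (S j) - distCdf D m)
      (samplesLaw D n) :=
    iIndepFun_pi (X := fun (_ : Fin n) k => indLe m k - distCdf D m)
      fun _ => (measurable_of_countable _).aemeasurable
  have hind' : iIndepFun (fun (j : Fin n) (S : Fin n → ℕ) => -(indLe m (S j) - distCdf D m))
      (samplesLaw D n) :=
    iIndepFun_pi (X := fun (_ : Fin n) k => -(indLe m k - distCdf D m))
      fun _ => (measurable_of_countable _).aemeasurable
  have h1 := HasSubgaussianMGF.measure_sum_ge_le_of_iIndepFun hind (s := Finset.univ)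
    (fun j _ => hsub j) (ε := n * ε) (by positivity)
  have h2 := HasSubgaussianMGF.measure_sum_ge_le_of_iIndepFun hind' (s := Finset.univ)
    (fun j _ => (hsub j).neg) (ε := n * ε) (by positivity)
  have he : -(n * ε) ^ 2 / (2 * ∑ _j : Fin n, (((‖(1 : ℝ) - 0‖₊ / 2) ^ 2 : NNReal) : ℝ)) =
      -(2 * n * ε ^ 2) := by
    simp
    field_simp
  push_cast at h1 h2 he
  rw [he] at h1 h2
  have hsum : ∀ S : Fin n → ℕ, ∑ j, (indLe m (S j) - distCdf D m) =
      n * (empCdf S m - distCdf D m) := by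
    intro S
    rw [empCdf_eq_sum, Finset.sum_sub_distrib]
    simp
    field_simp
  rw [two_mul]
  refine (measureReal_mono ?_).trans ((measureReal_union_le _ _).trans (add_le_add h1 h2))
  intro S hS
  rcases lt_abs.1 (Set.mem_ofPred.1 hS) with h | h
  · refine Or.inl ?_
    rw [Set.mem_ofPred, hsum]
    gcongr
  · refine Or.inr ?_
    rw [Set.mem_ofPred, Finset.sum_neg_distrib, hsum, ← mul_neg]
    gcongr

end Sampling

/-! ### Coupling with the search on the true CDF -/

theorem path_congr {R : ℕ} {d d' : ℕ → ℕ → Prop} (k : ℕ)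
    (h : ∀ i < k, d i (((path R d' i).1 + (path R d' i).2) / 2) ↔
      d' i (((path R d' i).1 + (path R d' i).2) / 2)) : path R d k = path R d' k := by
  induction k with
  | zero => rfl
  | succ k ih =>
    -- Paths that have agreed so far ask the same question, so agreement is needed only at the
    -- queries of `d'`.
    rw [path, path, ih fun i hi => h i (by omega)]
    have hk := propext (h k (by omega))
    rw [bisect, bisect, hk]

/-- The midpoint that the search queries in step `i` when it uses the values `F`. -/
noncomputable def query (R : ℕ) (q L : ℝ) (F : ℕ → ℝ) (r : ℕ → ℝ) (i : ℕ) : ℕ :=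
  ((path R (decision q L F r) i).1 + (path R (decision q L F r) i).2) / 2

section Divergence

variable (R : ℕ) (q L : ℝ) (F : ℕ → ℝ)

theorem measurable_path (i : ℕ) : Measurable fun r : ℕ → ℝ => path R (decision q L F r) i := by
  induction i with
  | zero => exact measurable_const
  | succ i ih =>
    have h : Measurable fun x : (ℕ × ℕ) × (ℕ → ℝ) => bisect (decision q L F x.2 i) x.1 := by
      refine measurable_from_prod_countable_right fun p => ?_
      unfold bisect
      by_cases hp : p.1 + 1 < p.2
      · simp only [hp, if_true]
        have hm : MeasurableSet {r : ℕ → ℝ | decision q L F r i ((p.1 + p.2) / 2)} := by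
          have h := measurable_pi_apply (X := fun _ : ℕ => ℝ) i
            (measurableSet_lower q L (F ((p.1 + p.2) / 2)))
          exact h
        exact Measurable.ite hm measurable_const measurable_const
      · simp only [hp, if_false]
        exact measurable_const
    exact h.comp (ih.prodMk measurable_id)

theorem measurable_query (i : ℕ) : Measurable fun r : ℕ → ℝ => query R q L F r i :=
  (measurable_of_countable fun p : ℕ × ℕ => (p.1 + p.2) / 2).comp (measurable_path R q L F i)

theorem query_congr {r r' : ℕ → ℝ} (i : ℕ) (h : ∀ j < i, r j = r' j) :
    query R q L F r i = query R q L F r' i := by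
  have : path R (decision q L F r) i = path R (decision q L F r') i :=
    path_congr i fun j hj => by rw [decision, decision, h j hj]
  rw [query, query, this]

theorem tapeLaw_query_inter (i m : ℕ) {B : Set ℝ} (hB : MeasurableSet B) :
    tapeLaw ({r | query R q L F r i = m} ∩ {r | r i ∈ B}) =
      tapeLaw {r | query R q L F r i = m} * unif B := by
  have hind : iIndepFun (fun (j : ℕ) (r : ℕ → ℝ) => r j) tapeLaw :=
    iIndepFun_infinitePi (X := fun _ => id) fun _ => measurable_id
  have h := hind.indepFun_finset (Finset.range i) {i} (by simp) fun j => measurable_pi_apply j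
  -- Padding the first `i` offsets with zeros exhibits the query as a function of them alone, hence
  -- independent of `r i`.
  let ext : (Finset.range i → ℝ) → ℕ → ℝ := fun z j => if h : j ∈ Finset.range i then z ⟨j, h⟩ else 0
  have hext : Measurable ext := by
    refine measurable_pi_lambda _ fun j => ?_
    by_cases hj : j ∈ Finset.range i
    · simpa only [ext, hj, dite_true] using measurable_pi_apply _
    · simpa only [ext, hj, dite_false] using measurable_const
  have hA : {r : ℕ → ℝ | query R q L F r i = m} =
      (fun r (j : Finset.range i) => r j) ⁻¹' {z | query R q L F (ext z) i = m} := by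
    ext r
    simp only [Set.mem_ofPred, Set.preimage_ofPred_eq]
    rw [query_congr R q L F i (r := r) (r' := ext fun j => r j)
      fun j hj => by simp [ext, hj]]
  have hBe : {r : ℕ → ℝ | r i ∈ B} =
      (fun r (j : ({i} : Finset ℕ)) => r j) ⁻¹' {z | z ⟨i, by simp⟩ ∈ B} := rfl
  have hunif : tapeLaw {r : ℕ → ℝ | r i ∈ B} = unif B := by
    have := (measurePreserving_eval_infinitePi (fun _ : ℕ => unif) i).measure_preimage
      hB.nullMeasurableSet
    exact this
  rw [← hunif, hA, hBe]
  exact h.measure_inter_preimage_eq_mul _ _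
    (((measurable_query R q L F i).comp hext) (measurableSet_singleton m))
    ((measurable_pi_apply _) hB)

/-- The searches with the values `G` and `F` disagree in some step `i < k` about the query that
the search with `F` makes. -/
def Diverge (G : ℕ → ℝ) (k : ℕ) (r : ℕ → ℝ) : Prop :=
  ∃ i < k, ¬ (Lower q L (r i) (G (query R q L F r i)) ↔ Lower q L (r i) (F (query R q L F r i)))

variable {R q L F} in
theorem path_eq_of_not_diverge {G : ℕ → ℝ} {k : ℕ} {r : ℕ → ℝ} (h : ¬ Diverge R q L F G k r) :
    path R (decision q L G r) k = path R (decision q L F r) k :=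
  path_congr k fun i hi => by
    by_contra h'
    exact h ⟨i, hi, h'⟩

theorem measurableSet_lower_ne (g g' : ℝ) :
    MeasurableSet {u | ¬ (Lower q L u g ↔ Lower q L u g')} :=
  ((measurableSet_lower q L g).iff (measurableSet_lower q L g')).compl

/-- The weights are the law of the queries made with `F`. They do not involve `G`, so they remain
constant when `G` becomes a random empirical CDF. -/
theorem tapeLaw_diverge_le {L : ℝ} (hL : 0 < L) (G : ℕ → ℝ) (k : ℕ) :
    tapeLaw {r | Diverge R q L F G k r} ≤
      ∑ i ∈ Finset.range k, ∑' m, tapeLaw {r | query R q L F r i = m} *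
        ENNReal.ofReal (|G m - F m| / L) := by
  have hsub : {r | Diverge R q L F G k r} ⊆ ⋃ i ∈ Finset.range k, ⋃ m,
      ({r | query R q L F r i = m} ∩
        {r | r i ∈ {u | ¬ (Lower q L u (G m) ↔ Lower q L u (F m))}}) := by
    rintro r ⟨i, hi, h⟩
    simp only [Set.mem_iUnion]
    exact ⟨i, Finset.mem_range.2 hi, _, rfl, h⟩
  refine (measure_mono hsub).trans ((measure_biUnion_finset_le _ _).trans ?_)
  refine Finset.sum_le_sum fun i _ => (measure_iUnion_le _).trans (ENNReal.tsum_le_tsum fun m => ?_)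
  rw [tapeLaw_query_inter R q L F i m (measurableSet_lower_ne q L _ _)]
  gcongr
  exact unif_lower_ne_le q hL _ _

theorem measurableSet_diverge {n : ℕ} (k : ℕ) :
    MeasurableSet {w : (Fin n → ℕ) × (ℕ → ℝ) | Diverge R q L F (empCdf w.1) k w.2} := by
  have h : Measurable fun w : (Fin n → ℕ) × (ℕ → ℝ) => Diverge R q L F (empCdf w.1) k w.2 := by
    refine measurable_from_prod_countable_right fun S => ?_
    refine measurableSet_setOfPred.1 ?_
    have : {r | Diverge R q L F (empCdf S) k r} = ⋃ i ∈ Finset.range k, ⋃ m,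
      ({r | query R q L F r i = m} ∩
        (fun r => r i) ⁻¹' {u | ¬ (Lower q L u (empCdf S m) ↔ Lower q L u (F m))}) := by
      ext r
      simp [Diverge]
    rw [this]
    exact .biUnion (Finset.countable_toSet _) fun i _ => .iUnion fun m =>
      ((measurable_query R q L F i) (measurableSet_singleton m)).inter
        ((measurable_pi_apply i) (measurableSet_lower_ne q L _ _))
  exact measurableSet_setOfPred.2 h

theorem measure_diverge_le (D : Measure ℕ) [IsProbabilityMeasure D] {n : ℕ} (hn : 0 < n) {L : ℝ}
    (hL : 0 < L) (k : ℕ) :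
    ((samplesLaw D n).prod tapeLaw) {w | Diverge R q L (distCdf D) (empCdf w.1) k w.2} ≤
      k * ENNReal.ofReal (1 / (2 * √n * L)) := by
  rw [Measure.prod_apply (measurableSet_diverge R q L _ k)]
  refine (lintegral_mono fun S => tapeLaw_diverge_le R q (distCdf D) hL (empCdf S) k).trans ?_
  rw [lintegral_finsetSum _ fun i _ => measurable_of_countable _]
  refine (Finset.sum_le_card_nsmul _ _ (ENNReal.ofReal (1 / (2 * √n * L))) fun i _ => ?_).trans
    (by simp)
  rw [lintegral_tsum fun m => (measurable_of_countable _).aemeasurable]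
  -- The events `query = m` partition the tapes, so the estimate, uniform in `m`, is not multiplied
  -- by the number of points.
  have hone : ∑' m, tapeLaw {r | query R q L (distCdf D) r i = m} = 1 := by
    have := tsum_measure_preimage_singleton (μ := tapeLaw) (Set.countable_univ (α := ℕ))
      (f := fun r => query R q L (distCdf D) r i)
      fun m _ => (measurable_query R q L (distCdf D) i) (measurableSet_singleton m)
    rw [Set.preimage_univ, measure_univ, tsum_univ
      (fun m => tapeLaw ((fun r => query R q L (distCdf D) r i) ⁻¹' {m}))] at this
    exact this
  calc _ ≤ ∑' m, tapeLaw {r | query R q L (distCdf D) r i = m} *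
        ENNReal.ofReal (1 / (2 * √n * L)) := by
        refine ENNReal.tsum_le_tsum fun m => ?_
        rw [lintegral_const_mul _ (measurable_of_countable _)]
        gcongr
        exact lintegral_abs_empCdf_sub_le D hn m hL
    _ = ENNReal.ofReal (1 / (2 * √n * L)) := by rw [ENNReal.tsum_mul_right, hone, one_mul]

end Divergence

/-! ### Replicability -/

theorem measurable_output {R : ℕ} (hR : 1 ≤ R) (q α ρ β : ℝ) (n : ℕ) :
    Measurable fun w : (Fin n → ℕ) × (ℕ → ℝ) => output R q α ρ β w.1 w.2 := by
  refine measurable_from_prod_countable_right fun S => ?_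
  simp only [output_eq hR]
  exact (measurable_of_countable fun p : ℕ × ℕ => (p.2 : ℝ)).comp (measurable_path R q _ _ _)

theorem isReplicable_output {R n : ℕ} {α ρ β : ℝ} (hR : 1 ≤ R) (hα : α ∈ Set.Ioo 0 1)
    (hρ : ρ ∈ Set.Ioo 0 1) (hβ : β ∈ Set.Ioo 0 (ρ / 3)) (hn : sampleSize R α ρ β ≤ n) (q : ℝ)
    (D : Measure ℕ) [IsProbabilityMeasure D] :
    IsReplicable n (output R q α ρ β) D tapeLaw ρ := by
  unfold IsReplicable
  obtain rfl | hR' := hR.eq_or_lt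
  · simp [output_eq, path]
  have hn0 : 0 < n := by
    have h := inv_le_of_sampleSize_le hR' hα hρ hβ hn
    have := inv_pos.2 hα.1
    exact_mod_cast (by linarith : (0 : ℝ) < n)
  set L := width R α ρ with hLdef
  have hLeq : L = 3 / 2 * α := width_eq hR' α hρ.1
  have hL : 0 < L := by rw [hLeq]; linarith [hα.1]
  set k := Nat.clog 2 R with hk
  set E : Set ((Fin n → ℕ) × (ℕ → ℝ)) :=
    {w | Diverge R q L (distCdf D) (empCdf w.1) k w.2} with hE
  have hEm : MeasurableSet E := measurableSet_diverge R q L _ k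
  have hE_le := measure_diverge_le R q D hn0 hL k
  -- Runs that both follow the ideal search have equal outputs.
  have hsub : {w : (Fin n → ℕ) × (Fin n → ℕ) × (ℕ → ℝ) |
      output R q α ρ β w.1 w.2.2 ≠ output R q α ρ β w.2.1 w.2.2} ⊆
      Prod.map id Prod.snd ⁻¹' E ∪ Prod.snd ⁻¹' E := by
    intro w hw
    by_contra h
    rw [Set.mem_union, not_or] at h
    refine hw ?_
    have h₁ : path R (decision q L (empCdf w.1) w.2.2) k = _ := path_eq_of_not_diverge h.1
    have h₂ : path R (decision q L (empCdf w.2.1) w.2.2) k = _ := path_eq_of_not_diverge h.2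
    rw [output_eq hR, output_eq hR, h₁, h₂]
  have h1 : ((samplesLaw D n).prod ((samplesLaw D n).prod tapeLaw)) (Prod.map id Prod.snd ⁻¹' E) =
      ((samplesLaw D n).prod tapeLaw) E :=
    ((MeasurePreserving.id _).prod measurePreserving_snd).measure_preimage hEm.nullMeasurableSet
  have h2 : ((samplesLaw D n).prod ((samplesLaw D n).prod tapeLaw)) (Prod.snd ⁻¹' E) =
      ((samplesLaw D n).prod tapeLaw) E :=
    measurePreserving_snd.measure_preimage hEm.nullMeasurableSet
  refine (measure_mono hsub).trans ((measure_union_le _ _).trans ?_)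
  rw [h1, h2]
  refine (add_le_add hE_le hE_le).trans ?_
  rw [← ENNReal.ofReal_natCast, ← ENNReal.ofReal_mul (by positivity),
    ← ENNReal.ofReal_add (by positivity) (by positivity)]
  refine ENNReal.ofReal_le_ofReal ?_
  have hsq := sq_le_of_sampleSize_le hρ.2 hβ hn
  have ht := one_le_logb_natCast hR'
  set t := Real.logb 2 R
  have hαρ : 0 < α * ρ := mul_pos hα.1 hρ.1
  -- With `k ≤ 2 * t`, `√n ≥ 2 * t / (α * ρ)` and `L = 3 / 2 * α`, each term `k / (2 * √n * L)` is
  -- at most `ρ / 3`.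
  have hroot : 2 * (t / (α * ρ)) ≤ √n := by
    refine Real.le_sqrt_of_sq_le ?_
    nlinarith [sq_nonneg (t / (α * ρ))]
  have hkt : (k : ℝ) ≤ 2 * t := clog_le_two_mul_logb hR'
  have hroot0 : 0 < √(n : ℝ) := Real.sqrt_pos.2 (by exact_mod_cast hn0)
  rw [← mul_div_assoc, div_le_iff₀ hαρ] at hroot
  rw [hLeq, ← two_mul, mul_one_div, mul_div_assoc', div_le_iff₀ (by have := hα.1; positivity)]
  nlinarith

/-! ### Correctness -/

/-- The interval of the binary search brackets the quantile, up to the accuracy `α`. -/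
theorem path_brackets {R : ℕ} {q L α : ℝ} (hR : 1 ≤ R) (hL : 0 < L) (hLα : L / 2 + α / 4 ≤ α)
    {F G : ℕ → ℝ} (hG : ∀ m ∈ Finset.Ico 1 R, |G m - F m| ≤ α / 4) (r : ℕ → ℝ) (i : ℕ) :
    ((path R (decision q L G r) i).1 = 0 ∨ F (path R (decision q L G r) i).1 < q + α) ∧
      ((path R (decision q L G r) i).2 = R ∨ q - α ≤ F (path R (decision q L G r) i).2) := by
  induction i with
  | zero => exact ⟨Or.inl rfl, Or.inl rfl⟩
  | succ i ih =>
    have hb := path_bounds hR (decision q L G r) i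
    rw [path, bisect]
    set p := path R (decision q L G r) i
    split_ifs with hp hd
    · refine ⟨ih.1, Or.inr ?_⟩
      -- A queried midpoint lies strictly between `0` and `R`, so accuracy at the interior points
      -- suffices.
      have h1 := hG ((p.1 + p.2) / 2) (Finset.mem_Ico.2 (by omega))
      have h2 := abs_gridRound_sub_le hL (r i) (G ((p.1 + p.2) / 2))
      have h3 : q ≤ gridRound L (r i) (G ((p.1 + p.2) / 2)) := hd
      rw [abs_le] at h1 h2
      dsimp only
      linarith
    · refine ⟨Or.inr ?_, ih.2⟩
      have h1 := hG ((p.1 + p.2) / 2) (Finset.mem_Ico.2 (by omega))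
      have h2 := abs_gridRound_sub_le hL (r i) (G ((p.1 + p.2) / 2))
      have h3 : gridRound L (r i) (G ((p.1 + p.2) / 2)) < q := not_le.1 hd
      rw [abs_le] at h1 h2
      dsimp only
      linarith
    · exact ih

/-- Absorbs the number of points of the union bound into the surplus `t² - 1` of the Hoeffding
exponent, `t = log₂ R`. At `R = 2` there is no surplus, so the count has to be `R - 1` rather than
`R`. -/
theorem pred_le_exp {R : ℕ} (hR : 2 ≤ R) {Λ : ℝ} (hΛ : 2 * Real.log 2 ≤ Λ) :
    (R : ℝ) - 1 ≤ Real.exp ((Real.logb 2 R ^ 2 - 1) * Λ) := by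
  have hlog := Real.log_pos one_lt_two
  obtain rfl | hR' := hR.eq_or_lt
  · norm_num
  -- From `2 ^ (3 / 2) ≤ 3 ≤ R`; it yields `t ≤ 2 * (t ^ 2 - 1)` below.
  have ht : 3 / 2 ≤ Real.logb 2 R := by
    rw [Real.le_logb_iff_rpow_le one_lt_two (by positivity)]
    have h3 : (3 : ℝ) ≤ R := by exact_mod_cast hR'
    refine le_trans ?_ h3
    refine le_of_sq_le_sq ?_ (by norm_num)
    rw [← Real.rpow_natCast, ← Real.rpow_mul two_pos.le]
    norm_num
  have hRe : (R : ℝ) = Real.exp (Real.logb 2 R * Real.log 2) := by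
    rw [Real.logb, div_mul_cancel₀ _ hlog.ne', Real.exp_log (by positivity)]
  calc (R : ℝ) - 1 ≤ R := by linarith
    _ = Real.exp (Real.logb 2 R * Real.log 2) := hRe
    _ ≤ Real.exp ((Real.logb 2 R ^ 2 - 1) * (2 * Real.log 2)) := by
      rw [Real.exp_le_exp, ← mul_assoc]
      refine mul_le_mul_of_nonneg_right ?_ hlog.le
      nlinarith
    _ ≤ _ := by
      rw [Real.exp_le_exp]
      refine mul_le_mul_of_nonneg_left hΛ ?_
      nlinarith

theorem union_bound_le {R n : ℕ} {α ρ β : ℝ} (hR : 2 ≤ R) (hα : α ∈ Set.Ioo 0 1)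
    (hρ : ρ ∈ Set.Ioo 0 1) (hβ : β ∈ Set.Ioo 0 (ρ / 3)) (hn : sampleSize R α ρ β ≤ n) :
    ((R : ℝ) - 1) * (2 * Real.exp (-(2 * n * (α / 4) ^ 2))) ≤ β := by
  have hβ0 := hβ.1
  have hα0 := hα.1
  have hρ0 := hρ.1
  set Λ := Real.log (2 / β) with hΛdef
  set t := Real.logb 2 R with ht
  have hΛ : 2 * Real.log 2 ≤ Λ := by
    rw [← Real.log_rpow two_pos]
    refine Real.log_le_log (by positivity) ?_
    rw [le_div_iff₀ hβ0]
    norm_num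
    linarith [hβ.2, hρ.2]
  have hΛ0 : 0 < Λ := lt_of_lt_of_le (by have := Real.log_pos one_lt_two; positivity) hΛ
  have hexp : t ^ 2 * Λ ≤ 2 * n * (α / 4) ^ 2 := by
    rw [sampleSize_eq] at hn
    have h1 := mul_le_mul_of_nonneg_right hn (show 0 ≤ α ^ 2 / 8 by positivity)
    have h2 : 8 * (t / (α * ρ)) ^ 2 * Λ * (α ^ 2 / 8) = t ^ 2 * Λ / ρ ^ 2 := by
      field_simp
    have h3 : t ^ 2 * Λ ≤ t ^ 2 * Λ / ρ ^ 2 := by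
      rw [le_div_iff₀ (by positivity)]
      exact mul_le_of_le_one_right (by positivity) (pow_le_one₀ hρ0.le hρ.2.le)
    linarith
  have hR1 : (0 : ℝ) ≤ R - 1 := by
    have : (2 : ℝ) ≤ R := by exact_mod_cast hR
    linarith
  have h2β : 2 * Real.exp (-Λ) = β := by
    rw [Real.exp_neg, Real.exp_log (by positivity)]
    field_simp
  calc ((R : ℝ) - 1) * (2 * Real.exp (-(2 * n * (α / 4) ^ 2)))
      ≤ Real.exp ((t ^ 2 - 1) * Λ) * (2 * Real.exp (-(t ^ 2 * Λ))) := by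
        gcongr
        exact pred_le_exp hR hΛ
    _ = 2 * Real.exp (-Λ) := by
        rw [mul_left_comm, ← Real.exp_add]
        ring_nf
    _ = β := h2β

/-- Settles the end points `0` and `R`, which the search never queries. -/
theorem distCdf_of_support {R : ℕ} (D : Measure ℕ) [IsProbabilityMeasure D]
    (hD : D (Set.Icc 1 R)ᶜ = 0) : distCdf D R = 1 ∧ distCdf D 0 = 0 := by
  constructor
  · have h : D (Set.Iic R)ᶜ = 0 := measure_mono_null (Set.compl_subset_compl.2 fun x hx => hx.2) hD
    rw [distCdf, measureReal_def, (prob_compl_eq_zero_iff measurableSet_Iic).1 h]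
    rfl
  · have h : D (Set.Iic 0) = 0 := by
      refine measure_mono_null (Set.subset_compl_comm.1 fun x hx => ?_) hD
      have := hx.1
      simp only [Set.mem_compl_iff, Set.mem_Iic]
      omega
    rw [distCdf, measureReal_def, h]
    rfl

theorem measure_correct_ge {R n : ℕ} {α ρ β q : ℝ} (hR : 1 ≤ R) (hα : α ∈ Set.Ioo 0 1)
    (hρ : ρ ∈ Set.Ioo 0 1) (hβ : β ∈ Set.Ioo 0 (ρ / 3)) (hn : sampleSize R α ρ β ≤ n)
    (hq : q ∈ Set.Icc 0 1) (D : Measure ℕ) [IsProbabilityMeasure D]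
    (hD : D (Set.Icc 1 R)ᶜ = 0) :
    ENNReal.ofReal (1 - β) ≤ ((samplesLaw D n).prod tapeLaw)
      {w | ∃ x : ℕ, 1 ≤ x ∧ x ≤ R ∧ output R q α ρ β w.1 w.2 = x ∧
        q - α ≤ distCdf D x ∧ distCdf D (x - 1) < q + α} := by
  have hα0 := hα.1
  obtain ⟨hFR, hF0⟩ := distCdf_of_support D hD
  -- For `R = 1` the sample bound is zero, so `n = 0` is possible; the search returns `1` at once.
  obtain rfl | hR' := hR.eq_or_lt
  · have huniv : {w : (Fin n → ℕ) × (ℕ → ℝ) | ∃ x : ℕ, 1 ≤ x ∧ x ≤ 1 ∧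
        output 1 q α ρ β w.1 w.2 = x ∧ q - α ≤ distCdf D x ∧ distCdf D (x - 1) < q + α} =
        Set.univ := by
      refine Set.eq_univ_of_forall fun w => ⟨1, le_rfl, le_rfl, ?_, ?_, ?_⟩
      · simp [output_eq, path]
      · rw [hFR]; linarith [hq.2]
      · rw [Nat.sub_self, hF0]; linarith [hq.1]
    rw [huniv, measure_univ]
    exact ENNReal.ofReal_le_one.2 (by linarith [hβ.1])
  have hL : width R α ρ = 3 / 2 * α := width_eq hR' α hρ.1
  have hn0 : 0 < n := by
    have h := inv_le_of_sampleSize_le hR' hα hρ hβ hn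
    have := inv_pos.2 hα.1
    exact_mod_cast (by linarith : (0 : ℝ) < n)
  -- All interior points are covered because the queries depend on the samples. Outside `B` the
  -- output is correct for every tape.
  set B : Set (Fin n → ℕ) :=
    ⋃ m ∈ Finset.Ico 1 R, {S | α / 4 < |empCdf S m - distCdf D m|} with hB
  have hBle : (samplesLaw D n).real B ≤ β := by
    refine (measureReal_biUnion_finset_le _ _).trans ?_
    refine (Finset.sum_le_card_nsmul _ _ _ fun m _ =>
      measure_abs_empCdf_sub_gt_le D hn0 m (by positivity : 0 ≤ α / 4)).trans ?_
    rw [Nat.card_Ico, nsmul_eq_mul, Nat.cast_sub hR, Nat.cast_one]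
    exact union_bound_le hR' hα hρ hβ hn
  have hsub : Bᶜ ×ˢ (Set.univ : Set (ℕ → ℝ)) ⊆ {w | ∃ x : ℕ, 1 ≤ x ∧ x ≤ R ∧
      output R q α ρ β w.1 w.2 = x ∧ q - α ≤ distCdf D x ∧ distCdf D (x - 1) < q + α} := by
    rintro ⟨S, r⟩ ⟨hS, -⟩
    have hG : ∀ m ∈ Finset.Ico 1 R, |empCdf S m - distCdf D m| ≤ α / 4 := by
      intro m hm
      by_contra h
      exact hS (Set.mem_biUnion hm (not_le.1 h))
    have hbr := path_brackets (q := q) (L := width R α ρ) hR (by rw [hL]; positivity)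
      (by rw [hL]; linarith) hG r (Nat.clog 2 R)
    have hend := path_clog hR (decision q (width R α ρ) (empCdf S) r)
    have hbd := path_bounds hR (decision q (width R α ρ) (empCdf S) r) (Nat.clog 2 R)
    refine ⟨_, ?_, hbd.2, output_eq hR q α ρ β S r, ?_, ?_⟩
    · omega
    · rcases hbr.2 with h | h
      · rw [h, hFR]; linarith [hq.2]
      · exact h
    · rw [hend, Nat.add_sub_cancel]
      rcases hbr.1 with h | h
      · rw [h, hF0]; linarith [hq.1]
      · exact h
  refine le_trans ?_ (measure_mono hsub)
  rw [Measure.prod_prod, measure_univ, mul_one]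
  refine ENNReal.ofReal_le_of_le_toReal ?_
  rw [← measureReal_def, probReal_compl_eq_one_sub (Set.to_countable B).measurableSet]
  linarith

end QuantileEst

theorem theoremB3 :
    ∃ (C : ℝ) (P : Polynomial ℕ),
      ∀ (R : ℕ) (α ρ β q : ℝ), 1 ≤ R → α ∈ Set.Ioo (0 : ℝ) 1 → ρ ∈ Set.Ioo (0 : ℝ) 1 →
        β ∈ Set.Ioo (0 : ℝ) (ρ / 3) → q ∈ Set.Icc (0 : ℝ) 1 →
        sampleSize R α ρ β
            ≤ C * (Real.logb 2 R ^ 2 / (α ^ 2 * ρ ^ 2) * Real.log (1 / β)) ∧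
        ∀ n : ℕ, sampleSize R α ρ β ≤ n →
          -- termination and running time, for all samples and all internal randomness
          (∀ (S : Fin n → ℕ) (r : ℕ → ℝ), (∀ i, r i ∈ Set.Ico (0 : ℝ) 1) →
            Terminates R q α ρ β S r ∧ runningTime R q α ρ β S r ≤ P.eval n) ∧
          -- the output is a random variable
          Measurable (fun w : (Fin n → ℕ) × (ℕ → ℝ) => output R q α ρ β w.1 w.2) ∧
          ∀ (D : Measure ℕ) [IsProbabilityMeasure D], D (Set.Icc 1 R)ᶜ = 0 →
            -- replicability
            IsReplicable n (output R q α ρ β) D tapeLaw ρ ∧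
            -- correctness
            ENNReal.ofReal (1 - β) ≤
              ((samplesLaw D n).prod tapeLaw)
                {w | ∃ x : ℕ, 1 ≤ x ∧ x ≤ R ∧ output R q α ρ β w.1 w.2 = x ∧
                  q - α ≤ distCdf D x ∧ distCdf D (x - 1) < q + α} := by
  refine ⟨16, 32 * .X ^ 2 + 181 * .X + 20, fun R α ρ β q hR hα hρ hβ hq =>
    ⟨sampleSize_le hρ.2 hβ, fun n hn => ⟨fun S r hr => ⟨terminates hR q α ρ β S r, ?_⟩,
      measurable_output hR q α ρ β n, fun D _ hD =>
        ⟨isReplicable_output hR hα hρ hβ hn q D, measure_correct_ge hR hα hρ hβ hn hq D hD⟩⟩⟩⟩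
  simpa using runningTime_le_quadratic hR hα hρ hβ hn q S r hr
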